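/- Let $G$ be a parent graph on $V=\{1,\dots,d\}$: a directed graph in which every node $i$ has a parent set $\mathrm{par}_i\subseteq\{i+1,\dots,d\}$ (arrows $i\leftarrow j$ for $j\in\mathrm{par}_i$). A distribution of a real random vector $Y=(Y_1,\dots,Y_d)$ *factorizes over* $G$ if it has a density, with respect to a product of $\sigma$-finite measures on $\mathbb R$, of the form $\prod_{i=1}^d f_{i|\mathrm{par}_i}(y_i\mid y_{\mathrm{par}_i})$ with conditional densities $f_{i|\mathrm{par}_i}$. For pairwise disjoint $s,t,u\subseteq V$ write $s\perp\!\!\!\perp t\mid u$ if $Y_s$ and $Y_t$ are conditionally independent given $Y_u$; the graph *implies* $s\perp\!\!\!\perp t\mid u$ if this holds in every distribution that factorizes over $G$. A distribution is *generated over* $G$ if it factorizes over $G$ and satisfies precisely the independences $s\perp\!\!\!\perp t\mid u$ implied by $G$ and no others. Let $\mathrm{In}[X]$ be obtained from a nonnegative integer matrix $X$ by replacing each nonzero entry by $1$. For a binary matrix $X$ and an index $k$, the partial closure $\mathrm{zer}_kX$ is the binary matrix that has $kk$-entry $1$, agrees with $X$ in the other entries of row $k$ and of column $k$, and whose $ij$-entry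 for $i,j\ne k$ is $1$ iff $X_{ij}=1$ or $X_{ik}X_{kj}=1$; $\mathrm{zer}_sX$ applies $\mathrm{zer}_k$ successively for all $k\in s$ (in increasing order). Let $\mathcal A$ be the edge matrix of $G$ ($\mathcal A_{ij}=1$ iff $i=j$ or $j\in\mathrm{par}_i$, otherwise $0$). For $a\subseteq V$ and $b=V\setminus a$ let $$\mathcal B=\mathrm{zer}_a\mathcal A,\qquad \mathcal H=\mathrm{zer}_b\,\mathrm{In}\begin{pmatrix}\mathcal I_{aa}&\mathcal B_{ba}^{T}\\ \mathcal B_{ba}&\mathcal I_{bb}+\mathcal B_{ba}\mathcal B_{ba}^{T}\end{pmatrix},$$ $$\mathcal P_{a|b}=\mathrm{In}[\mathcal B_{ab}+\mathcal B_{aa}\mathcal H_{ab}\mathcal B_{bb}],\quad \mathcal S_{aa|b}=\mathrm{In}[\mathcal B_{aa}\mathcal H_{aa}\mathcal B_{aa}^{T}],\quad \mathcal S^{bb.a}=\mathrm{In}[\mathcal B_{bb}^{T}\mathcal H_{bb}\mathcal B_{bb}].$$ Let $V$ be partitioned into $M,\alpha,\beta,C$ (possibly empty), put $a=\alpha\cup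 M$ and $b=\beta\cup C$, and let $\mathcal P_{\alpha|\beta.C}=(\mathcal P_{a|b})_{\alpha,\beta}$, $\mathcal S_{\alpha M|b}=(\mathcal S_{aa|b})_{\alpha,M}$, $\mathcal S^{\beta C.a}=(\mathcal S^{bb.a})_{\beta,C}$. **Proposition 1.** For every distribution generated over $G$: (i) $\alpha\perp\!\!\!\perp\beta\mid C$ holds if and only if $\mathcal P_{\alpha|\beta.C}=0$; (ii) $\alpha\perp\!\!\!\perp M\mid b$ holds if and only if $\mathcal S_{\alpha M|b}=0$; (iii) $\beta\perp\!\!\!\perp C$ holds if and only if $\mathcal S^{\beta C.a}=0$. Moreover, the graph implies $\alpha\perp\!\!\!\perp\beta\mid C$, respectively $\alpha\perp\!\!\!\perp M\mid b$, respectively $\beta\perp\!\!\!\perp C$, if and only if $\mathcal P_{\alpha|\beta.C}=0$, respectively $\mathcal S_{\alpha M|b}=0$, respectively $\mathcal S^{\beta C.a}=0$. -/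

import Mathlib

open MeasureTheory ProbabilityTheory
open scoped NNReal ENNReal

/-- A parent graph on the ordered node set `V = (1, …, d)` (here `Fin d`): every node `i` has a set
`par i` of parents, all of them later in the ordering. An arrow `i ← j` is present iff
`j ∈ par i`. -/
structure ParentGraph (d : ℕ) where
  par : Fin d → Finset (Fin d)
  lt_of_mem_par : ∀ i j, j ∈ par i → i < j

namespace EdgeMatrix

variable {d : ℕ}

/-- The indicator operator `In[·]`: every nonzero entry becomes one. -/
def ind {m n : Type*} (X : Matrix m n ℕ) : Matrix m n ℕ :=
  Matrix.of fun i j => if X i j = 0 then 0 else 1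

/-- The submatrix `X_{s,t}`. -/
def block (X : Matrix (Fin d) (Fin d) ℕ) (s t : Finset (Fin d)) : Matrix s t ℕ :=
  X.submatrix (fun i => (i : Fin d)) (fun j => (j : Fin d))

/-- Partial closure `zer_k X` of a binary matrix with respect to one index `k`. -/
def zerStep (k : Fin d) (X : Matrix (Fin d) (Fin d) ℕ) : Matrix (Fin d) (Fin d) ℕ :=
  Matrix.of fun i j =>
    if i = k ∧ j = k then 1
    else if i = k ∨ j = k then X i j
    else if X i j = 1 ∨ X i k * X k j = 1 then 1
    else 0

/-- Partial closure `zer_s X`: `zer_k` is applied in sequence for all `k ∈ s`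
(taken in increasing order). -/
def zer (s : Finset (Fin d)) (X : Matrix (Fin d) (Fin d) ℕ) : Matrix (Fin d) (Fin d) ℕ :=
  (s.sort (· ≤ ·)).foldl (fun Y k => zerStep k Y) X

end EdgeMatrix

namespace ParentGraph

open EdgeMatrix

variable {d : ℕ} (G : ParentGraph d)

/-- The edge matrix `𝒜` of the parent graph. -/
def edgeMatrix : Matrix (Fin d) (Fin d) ℕ :=
  Matrix.of fun i j => if j ∈ G.par i ∨ i = j then 1 else 0

/-- `ℬ = zer_a 𝒜`, the edge matrix of the partial ancestor graph with respect to `a`. (Nodes keep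
their names, so that no reordering of rows and columns is needed.) -/
def matB (a : Finset (Fin d)) : Matrix (Fin d) (Fin d) ℕ :=
  zer a G.edgeMatrix

/-- The symmetric matrix with blocks `ℐ_aa`, `(ℬ_ba)ᵀ`, `ℬ_ba`, `ℐ_bb + ℬ_ba (ℬ_ba)ᵀ`,
where `b = V \ a`. -/
def preH (a : Finset (Fin d)) : Matrix (Fin d) (Fin d) ℕ :=
  Matrix.of fun i j =>
    if i ∈ a then
      if j ∈ a then (1 : Matrix (Fin d) (Fin d) ℕ) i j else G.matB a j i
    else
      if j ∈ a then G.matB a i j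
      else (1 : Matrix (Fin d) (Fin d) ℕ) i j + ∑ h ∈ a, G.matB a i h * G.matB a j h

/-- `ℋ = zer_b` of the preceding matrix, `b = V \ a`; partial closure acts on binary matrices, so
the indicator operator is applied first. -/
def matH (a : Finset (Fin d)) : Matrix (Fin d) (Fin d) ℕ :=
  zer aᶜ (ind (G.preH a))

/-- `𝒫_{a|b} = In[ℬ_ab + ℬ_aa ℋ_ab ℬ_bb]`, to be used for `b = V \ a`. -/
def edgeP (a b : Finset (Fin d)) : Matrix a b ℕ :=
  ind (block (G.matB a) a b + block (G.matB a) a a * block (G.matH a) a b * block (G.matB a) b b)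

/-- `𝒮_{aa|b} = In[ℬ_aa ℋ_aa (ℬ_aa)ᵀ]`, where `b = V \ a`. -/
def edgeCov (a : Finset (Fin d)) : Matrix a a ℕ :=
  ind (block (G.matB a) a a * block (G.matH a) a a * (block (G.matB a) a a).transpose)

/-- `𝒮^{bb.a} = In[(ℬ_bb)ᵀ ℋ_bb ℬ_bb]`, to be used for `b = V \ a`. -/
def edgeCon (a b : Finset (Fin d)) : Matrix b b ℕ :=
  ind ((block (G.matB a) b b).transpose * block (G.matH a) b b * block (G.matB a) b b)

/-- `𝒫_{α|β.C} = (𝒫_{a|b})_{α,β}`, where `a = α ∪ M` and `b = β ∪ C`. -/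
def inducedP (M α β C : Finset (Fin d)) : Matrix α β ℕ :=
  (G.edgeP (α ∪ M) (β ∪ C)).submatrix
    (fun i => ⟨i, Finset.mem_union_left M i.2⟩) (fun j => ⟨j, Finset.mem_union_left C j.2⟩)

/-- `𝒮_{αM|b} = (𝒮_{aa|b})_{α,M}`, where `a = α ∪ M` and `b = V \ a`. -/
def inducedCov (M α : Finset (Fin d)) : Matrix α M ℕ :=
  (G.edgeCov (α ∪ M)).submatrix
    (fun i => ⟨i, Finset.mem_union_left M i.2⟩) (fun j => ⟨j, Finset.mem_union_right α j.2⟩)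

/-- `𝒮^{βC.a} = (𝒮^{bb.a})_{β,C}`, where `a = α ∪ M` and `b = β ∪ C`. -/
def inducedCon (M α β C : Finset (Fin d)) : Matrix β C ℕ :=
  (G.edgeCon (α ∪ M) (β ∪ C)).submatrix
    (fun i => ⟨i, Finset.mem_union_left C i.2⟩) (fun j => ⟨j, Finset.mem_union_right β j.2⟩)

/-- The distribution `P` of `Y = (Y_1, …, Y_d)` has a density (with respect to some product of
σ-finite measures on `ℝ`) of the form `f_V(y) = ∏ i, f_{i | par i}(y_i | y_{par i})`,
where the factors are conditional densities. -/
def Factorizes (P : Measure (Fin d → ℝ)) : Prop :=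
  ∃ (ν : Fin d → Measure ℝ) (_ : ∀ i, SigmaFinite (ν i))
    (f : (i : Fin d) → ℝ → (G.par i → ℝ) → ℝ≥0),
    (∀ i, Measurable (Function.uncurry (f i))) ∧
    (∀ i x, ∫⁻ t, (f i t x : ℝ≥0∞) ∂(ν i) = 1) ∧
    P = (Measure.pi ν).withDensity
      (fun y => ∏ i, (f i (y i) ((G.par i).restrict y) : ℝ≥0∞))

end ParentGraph

/-- `s ⊥⊥ t | u` under the distribution `P` of `Y`: the subvectors `Y_s` and `Y_t` are conditionally
independent given `Y_u`. For `u = ∅` this is the independence of `Y_s` and `Y_t`. -/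
def CondIndepNodes {d : ℕ} (P : Measure (Fin d → ℝ)) [IsProbabilityMeasure P]
    (s t u : Finset (Fin d)) : Prop :=
  CondIndepFun (MeasurableSpace.comap u.restrict inferInstance)
    (Finset.measurable_restrict u).comap_le
    (s.restrict : (Fin d → ℝ) → s → ℝ) (t.restrict : (Fin d → ℝ) → t → ℝ) P

namespace ParentGraph

variable {d : ℕ} (G : ParentGraph d)

/-- `s ⊥⊥ t | u` belongs to the independence structure captured by the graph: it holds
in every distribution that factorizes over the graph. -/
def Implies (s t u : Finset (Fin d)) : Prop :=
  ∀ (Q : Measure (Fin d → ℝ)) [IsProbabilityMeasure Q], G.Factorizes Q → CondIndepNodes Q s t u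

/-- `P` is generated over the graph: its density factorizes, and `P` satisfies precisely the
independences captured by the graph and no others. -/
def Generates (P : Measure (Fin d → ℝ)) [IsProbabilityMeasure P] : Prop :=
  G.Factorizes P ∧
    ∀ s t u : Finset (Fin d), Disjoint s t → Disjoint s u → Disjoint t u →
      (CondIndepNodes P s t u ↔ G.Implies s t u)

end ParentGraph

/-!
The three matrix conditions and the three independences are both compared with one graphical
condition, separation in the moral graph: a colouring of the ancestors of `s ∪ t ∪ u` outside `u`
by two colours, one for `s` and one for `t`, such that no arrow and no common child in `u` joins
nodes of different colours (`ParentGraph.IsSeparation`).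

A separation gives the independence (`IsSeparation.implies`). Integrating out the nodes that are
not ancestors of `s ∪ t ∪ u` removes exactly their factors from the density
(`lmarginal_prod_factor`). Each remaining factor involves, apart from `u`, nodes of a single colour,
so that the density splits into a function of one colour and `u` and a function of the other colour
and `u`. By Bayes' formula for conditional probabilities (`condProb_eq_lmarginal_div`) this is
conditional independence.

An independence that the graph implies gives a separation (`Implies.exists_isSeparation`), because
it holds in the consensus model for `u`. There the variables take the values `0`, `1`, `2`; a node
outside `u` may be `0` only if all its parents outside `u` are `0`, and `1` only if they all
are `1`; a node in `u` is `0` precisely if its parents outside `u` are all `0` or all `1`. The events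
`Y_s = 0` and `Y_t = 1` are each compatible with `Y_u = 0`, hence by conditional independence
they are so jointly; and in any possible outcome with `Y_s = 0`, `Y_t = 1` and `Y_u = 0`
the values of the nodes form a separation.

The nonzero entries of a partial closure are given by the paths through the closed nodes
(`EdgeMatrix.zer_ne_zero_iff`). So `ℬ` records directed paths with inner nodes in `a`, and `ℋ`
records chains of nodes outside `a` of which neighbours share such an ancestor in `a`. The colour
of a separation is constant along both, provided that a node of `u` gets the colour of its parents;
hence a separation forces the matrix to vanish. Conversely, when the matrix vanishes, the nodes
that `ℬ` and `ℋ` connect with the first of the two sets form a colour class. Finally, in a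
distribution generated over the graph, an independence holds if and only if the graph implies it.
-/

/-! ### Integrating out coordinates -/

section Marginals

variable {ι : Type*} [DecidableEq ι] {X : ι → Type*} [∀ i, MeasurableSpace (X i)]
  {ν : ∀ i, Measure (X i)}

theorem dependsOn_lmarginal {f : (∀ i, X i) → ℝ≥0∞} {v : Set ι} (hf : DependsOn f v)
    (s : Finset ι) : DependsOn (∫⋯∫⁻_s, f ∂ν) (v \ s) := by
  intro x y hxy
  refine lintegral_congr fun z => hf fun i hi => ?_
  by_cases his : i ∈ s
  · simp [Function.updateFinset, his]
  · simp [Function.updateFinset, his, hxy i ⟨hi, his⟩]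

theorem lmarginal_mul_left [∀ i, SigmaFinite (ν i)] {s : Finset ι} {c f : (∀ i, X i) → ℝ≥0∞}
    (hc : DependsOn c (s : Set ι)ᶜ) (hf : Measurable f) :
    ∫⋯∫⁻_s, (c * f) ∂ν = c * ∫⋯∫⁻_s, f ∂ν := by
  ext x
  have h : ∀ y : ∀ i : s, X i, c (Function.updateFinset x s y) = c x := fun y =>
    hc fun i hi => by
      have hi' : i ∉ s := hi
      simp [Function.updateFinset, hi']
  simp only [lmarginal, Pi.mul_apply, h]
  exact lintegral_const_mul _ (hf.comp measurable_updateFinset)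

end Marginals

/-! ### Conditional probabilities from densities -/

section Density

variable {d : ℕ} {ν : Fin d → Measure ℝ}

theorem dependsOn_indicator_restrict_preimage (s : Finset (Fin d)) (A : Set (s → ℝ)) :
    DependsOn (((s.restrict : (Fin d → ℝ) → s → ℝ) ⁻¹' A).indicator
      (1 : (Fin d → ℝ) → ℝ≥0∞)) (s : Set (Fin d)) := by
  intro x y hxy
  have h : s.restrict x = s.restrict y := funext fun i => hxy i i.2
  by_cases hx : s.restrict x ∈ A
  · have hy : s.restrict y ∈ A := h ▸ hx
    simp [Set.indicator, hx, hy]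
  · have hy : s.restrict y ∉ A := h ▸ hx
    simp [Set.indicator, hx, hy]

theorem dependsOn_lmarginal_compl (f : (Fin d → ℝ) → ℝ≥0∞) (u : Finset (Fin d)) :
    DependsOn (∫⋯∫⁻_uᶜ, f ∂ν) (u : Set (Fin d)) :=
  (dependsOn_lmarginal (dependsOn_univ f) uᶜ).mono fun i hi => by simpa using hi.2

/-- A measurable function that depends only on the coordinates in `u` is measurable for the
σ-algebra generated by these coordinates. -/
theorem measurable_comap_restrict_of_dependsOn {f : (Fin d → ℝ) → ℝ≥0∞} {u : Finset (Fin d)}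
    (hf : Measurable f) (hu : DependsOn f (u : Set (Fin d))) :
    Measurable[MeasurableSpace.comap (u.restrict : (Fin d → ℝ) → u → ℝ) inferInstance] f := by
  have h : f = (fun z : u → ℝ => f (Function.updateFinset 0 u z)) ∘ u.restrict := by
    ext x
    refine hu fun i hi => ?_
    have hi' : i ∈ u := hi
    simp [Function.updateFinset, hi']
  rw [h]
  exact (hf.comp measurable_updateFinset).comp (comap_measurable _)

variable [∀ i, SigmaFinite (ν i)]

theorem lintegral_mul_eq_lmarginal {F p : (Fin d → ℝ) → ℝ≥0∞} {u : Finset (Fin d)}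
    (hF : Measurable F) (hu : DependsOn F (u : Set (Fin d))) (hp : Measurable p) :
    ∫⁻ y, (F * p) y ∂Measure.pi ν = (∫⋯∫⁻_u, (F * ∫⋯∫⁻_uᶜ, p ∂ν) ∂ν) 0 := by
  rw [lintegral_eq_lmarginal_univ (0 : Fin d → ℝ), ← Finset.union_compl u,
    lmarginal_union _ _ (hF.mul hp) disjoint_compl_right, lmarginal_mul_left (by simpa using hu) hp]

theorem lintegral_eq_lmarginal_of_withDensity {F p : (Fin d → ℝ) → ℝ≥0∞} {u : Finset (Fin d)}
    {P : Measure (Fin d → ℝ)} (hP : P = (Measure.pi ν).withDensity p)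
    (hF : Measurable F) (hu : DependsOn F (u : Set (Fin d))) (hp : Measurable p) :
    ∫⁻ y, F y ∂P = (∫⋯∫⁻_u, (F * ∫⋯∫⁻_uᶜ, p ∂ν) ∂ν) 0 := by
  rw [hP, lintegral_withDensity_eq_lintegral_mul _ hp hF, mul_comm,
    lintegral_mul_eq_lmarginal hF hu hp]

/-- The density of `Y_u` is finite almost everywhere for the product measure. -/
theorem ae_lmarginal_compl_updateFinset_lt_top {p : (Fin d → ℝ) → ℝ≥0∞} (hp : Measurable p)
    {P : Measure (Fin d → ℝ)} [IsProbabilityMeasure P] (hP : P = (Measure.pi ν).withDensity p)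
    (u : Finset (Fin d)) :
    ∀ᵐ z ∂(Measure.pi fun i : u => ν i),
      (∫⋯∫⁻_uᶜ, p ∂ν) (Function.updateFinset (0 : Fin d → ℝ) u z) < ∞ := by
  have h := lintegral_eq_lmarginal_of_withDensity (F := 1) (u := u) hP measurable_one
    (fun x y _ => rfl) hp
  rw [one_mul] at h
  simp only [Pi.one_apply, lintegral_one, measure_univ] at h
  refine ae_lt_top ((hp.lmarginal ν).comp measurable_updateFinset) ?_
  change (∫⋯∫⁻_u, (∫⋯∫⁻_uᶜ, p ∂ν) ∂ν) 0 ≠ ∞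
  rw [← h]
  exact ENNReal.one_ne_top

/-- The density of `Y_u` is almost surely positive and finite. -/
theorem ae_lmarginal_compl_ne {p : (Fin d → ℝ) → ℝ≥0∞} (hp : Measurable p)
    {P : Measure (Fin d → ℝ)} [IsProbabilityMeasure P] (hP : P = (Measure.pi ν).withDensity p)
    (u : Finset (Fin d)) :
    ∀ᵐ y ∂P, (∫⋯∫⁻_uᶜ, p ∂ν) y ≠ 0 ∧ (∫⋯∫⁻_uᶜ, p ∂ν) y ≠ ∞ := by
  set q := ∫⋯∫⁻_uᶜ, p ∂ν with hq
  have mq : Measurable q := hp.lmarginal ν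
  have dq : DependsOn q (u : Set (Fin d)) := dependsOn_lmarginal_compl p u
  have mbad : MeasurableSet {y | q y = 0 ∨ q y = ∞} :=
    (mq (measurableSet_singleton 0)).union (mq (measurableSet_singleton ∞))
  have dbad : DependsOn ({y | q y = 0 ∨ q y = ∞}.indicator (1 : (Fin d → ℝ) → ℝ≥0∞))
      (u : Set (Fin d)) := fun x y hxy => by
    simp [Set.indicator, dq hxy]
  have h0 := lintegral_eq_lmarginal_of_withDensity hP (measurable_one.indicator mbad) dbad hp
  rw [lintegral_indicator_one mbad] at h0
  have h1 : P {y | q y = 0 ∨ q y = ∞} = 0 := by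
    rw [h0, lmarginal, lintegral_eq_zero_iff]
    · filter_upwards [ae_lmarginal_compl_updateFinset_lt_top hp hP u] with z hz
      rw [← hq] at hz ⊢
      by_cases h : q (Function.updateFinset 0 u z) = 0
      · simp [h]
      · simp [Set.indicator, h, hz.ne]
    · exact ((measurable_one.indicator mbad).mul mq).comp measurable_updateFinset
  filter_upwards [measure_eq_zero_iff_ae_notMem.1 h1] with y hy
  simpa [not_or] using hy

/-- Bayes' formula: if `P` has density `p` with respect to a product measure, then the conditional
probability of an event given `Y_u` is a ratio of integrals over the remaining coordinates. -/
theorem condProb_eq_lmarginal_div {p : (Fin d → ℝ) → ℝ≥0∞} (hp : Measurable p)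
    {P : Measure (Fin d → ℝ)} [IsProbabilityMeasure P] (hP : P = (Measure.pi ν).withDensity p)
    (u : Finset (Fin d)) {A : Set (Fin d → ℝ)} (hA : MeasurableSet A) :
    P⟦A | MeasurableSpace.comap (u.restrict : (Fin d → ℝ) → u → ℝ) inferInstance⟧ =ᵐ[P]
      fun y => ((∫⋯∫⁻_uᶜ, (A.indicator 1 * p) ∂ν) y / (∫⋯∫⁻_uᶜ, p ∂ν) y).toReal := by
  have hm : MeasurableSpace.comap (u.restrict : (Fin d → ℝ) → u → ℝ) inferInstance ≤
    MeasurableSpace.pi := (Finset.measurable_restrict u).comap_le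
  have mA : Measurable (A.indicator (1 : (Fin d → ℝ) → ℝ≥0∞)) := measurable_one.indicator hA
  set q := ∫⋯∫⁻_uᶜ, p ∂ν with hq
  set qA := ∫⋯∫⁻_uᶜ, (A.indicator 1 * p) ∂ν with hqA
  have mq : Measurable q := hp.lmarginal ν
  have mqA : Measurable qA := (mA.mul hp).lmarginal ν
  have dq : DependsOn q (u : Set (Fin d)) := dependsOn_lmarginal_compl p u
  have dqA : DependsOn qA (u : Set (Fin d)) := dependsOn_lmarginal_compl _ u
  have hle : ∀ y, qA y ≤ q y := lmarginal_mono fun y => by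
    by_cases hy : y ∈ A <;> simp [hy]
  have hR1 : ∀ y, (qA / q) y ≤ 1 := fun y => by
    simpa using ENNReal.div_le_of_le_mul ((one_mul (q y)).symm ▸ hle y)
  have mR : Measurable (qA / q) := mqA.div mq
  have dR : DependsOn (qA / q) (u : Set (Fin d)) := fun x y hxy => by
    simp only [Pi.div_apply, dq hxy, dqA hxy]
  have hint : Integrable (fun y => ((qA / q) y).toReal) P :=
    integrable_toReal_of_lintegral_ne_top mR.aemeasurable
      ((lintegral_mono hR1).trans_lt (by simp)).ne
  refine (ae_eq_condExp_of_forall_setIntegral_eq hm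
    ((integrable_const (1 : ℝ)).indicator hA) (fun _ _ _ => hint.integrableOn) ?_
    ((measurable_comap_restrict_of_dependsOn mR dR).ennreal_toReal.stronglyMeasurable
      |>.aestronglyMeasurable)).symm
  intro C hC _
  have hC' := hm C hC
  have mC : Measurable (C.indicator (1 : (Fin d → ℝ) → ℝ≥0∞)) := measurable_one.indicator hC'
  have dC : DependsOn (C.indicator (1 : (Fin d → ℝ) → ℝ≥0∞)) (u : Set (Fin d)) := by
    obtain ⟨C', _, rfl⟩ := hC
    exact dependsOn_indicator_restrict_preimage u C'
  have e1 : ∫⁻ y in C, (qA / q) y ∂P = P (A ∩ C) := by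
    calc ∫⁻ y in C, (qA / q) y ∂P =
        ∫⁻ y, (C.indicator (1 : (Fin d → ℝ) → ℝ≥0∞) * (qA / q)) y ∂P := by
          rw [← lintegral_indicator hC']
          congr 1; ext y
          by_cases hy : y ∈ C <;> simp [hy]
      _ = (∫⋯∫⁻_u, (C.indicator 1 * (qA / q) * q) ∂ν) 0 :=
          lintegral_eq_lmarginal_of_withDensity hP (mC.mul mR)
            (fun x y hxy => by simp only [Pi.mul_apply, dC hxy, dR hxy]) hp
      _ = (∫⋯∫⁻_u, (C.indicator 1 * qA) ∂ν) 0 := by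
          refine lintegral_congr_ae ?_
          filter_upwards [ae_lmarginal_compl_updateFinset_lt_top hp hP u] with z hz
          simp only [Pi.mul_apply, Pi.div_apply, mul_assoc]
          congr 1
          -- where the marginal density vanishes, so does its restriction to `A`
          rcases eq_or_ne (q (Function.updateFinset 0 u z)) 0 with h0 | h0
          · have := hle (Function.updateFinset 0 u z)
            rw [h0] at this
            simp [h0, le_antisymm this bot_le]
          · exact ENNReal.div_mul_cancel h0 hz.ne
      _ = ∫⁻ y, (C.indicator (1 : (Fin d → ℝ) → ℝ≥0∞) *
            (A.indicator (1 : (Fin d → ℝ) → ℝ≥0∞) * p)) y ∂Measure.pi ν :=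
          (lintegral_mul_eq_lmarginal mC dC (mA.mul hp)).symm
      _ = P (A ∩ C) := by
          rw [hP, withDensity_apply _ (hA.inter hC'), ← lintegral_indicator (hA.inter hC')]
          congr 1; ext y
          by_cases hy : y ∈ C <;> by_cases hy' : y ∈ A <;> simp [hy, hy']
  rw [integral_toReal mR.aemeasurable.restrict
    (ae_of_all _ fun y => (hR1 y).trans_lt ENNReal.one_lt_top), e1,
    setIntegral_indicator hA]
  simp [Measure.real, Set.inter_comm]

/-- If the density of the subvector that remains after integrating out the coordinates in `N` is a
product of a function of `(Y_S, Y_u)` and a function of `(Y_T, Y_u)`, then `S ⊥⊥ T | u`. -/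
theorem condIndepNodes_of_lmarginal_eq_mul {p g h : (Fin d → ℝ) → ℝ≥0∞} (hp : Measurable p)
    {P : Measure (Fin d → ℝ)} [IsProbabilityMeasure P] (hP : P = (Measure.pi ν).withDensity p)
    {S T u N : Finset (Fin d)} (hST : Disjoint S T) (hSN : Disjoint S N) (hTN : Disjoint T N)
    (hu : uᶜ = S ∪ (T ∪ N))
    (hg : Measurable g) (hh : Measurable h)
    (hgS : DependsOn g ((S ∪ u : Finset (Fin d)) : Set (Fin d)))
    (hhT : DependsOn h ((T ∪ u : Finset (Fin d)) : Set (Fin d)))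
    (hgh : ∫⋯∫⁻_N, p ∂ν = g * h) {s t : Finset (Fin d)} (hs : s ⊆ S) (ht : t ⊆ T) :
    CondIndepNodes P s t u := by
  have hmem : ∀ i, i ∉ u ↔ i ∈ S ∨ i ∈ T ∨ i ∈ N := fun i => by
    rw [← Finset.mem_compl, hu]; simp
  have hSN' := Finset.disjoint_left.1 hSN
  have hTN' := Finset.disjoint_left.1 hTN
  have hST' := Finset.disjoint_left.1 hST
  have key : ∀ φ ψ : (Fin d → ℝ) → ℝ≥0∞, Measurable φ → Measurable ψ →
      DependsOn φ (S : Set (Fin d)) → DependsOn ψ (T : Set (Fin d)) →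
      ∫⋯∫⁻_uᶜ, (φ * ψ * p) ∂ν = (∫⋯∫⁻_S, (φ * g) ∂ν) * ∫⋯∫⁻_T, (ψ * h) ∂ν := by
    intro φ ψ hφ hψ hφS hψT
    have h1 : DependsOn (φ * ψ) (N : Set (Fin d))ᶜ := fun x y hxy => by
      simp only [Pi.mul_apply]
      rw [hφS fun i hi => hxy i (hSN' hi), hψT fun i hi => hxy i (hTN' hi)]
    have h2 : DependsOn (φ * g) (T : Set (Fin d))ᶜ := fun x y hxy => by
      simp only [Pi.mul_apply]
      rw [hφS fun i hi => hxy i (hST' hi), hgS fun i hi => hxy i ?_]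
      have := hmem i
      simp only [Finset.coe_union, Set.mem_union, Finset.mem_coe] at hi
      rcases hi with hi | hi
      · exact hST' hi
      · intro hT
        exact (this.2 (Or.inr (Or.inl hT))) hi
    have h3 : DependsOn (∫⋯∫⁻_T, (ψ * h) ∂ν) (S : Set (Fin d))ᶜ := by
      have : DependsOn (ψ * h) ((T ∪ u : Finset (Fin d)) : Set (Fin d)) := fun x y hxy => by
        simp only [Pi.mul_apply]
        rw [hψT fun i hi => hxy i (by simp_all), hhT hxy]
      refine (dependsOn_lmarginal this T).mono ?_
      rintro i ⟨hi, hiT⟩ hiS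
      have := (hmem i).2 (Or.inl hiS)
      simp_all
    rw [hu, lmarginal_union _ _ ((hφ.mul hψ).mul hp) (by
        rw [Finset.disjoint_union_right]; exact ⟨hST, hSN⟩),
      lmarginal_union _ _ ((hφ.mul hψ).mul hp) hTN, lmarginal_mul_left h1 hp, hgh,
      show φ * ψ * (g * h) = (φ * g) * (ψ * h) by ring, lmarginal_mul_left h2 (hψ.mul hh),
      mul_comm, lmarginal_mul_left h3 (hφ.mul hg), mul_comm]
  rw [CondIndepNodes, condIndepFun_iff_condExp_inter_preimage_eq_mul
    (Finset.measurable_restrict s) (Finset.measurable_restrict t)]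
  intro A B hA hB
  have hA' := Finset.measurable_restrict (X := fun _ : Fin d => ℝ) s hA
  have hB' := Finset.measurable_restrict (X := fun _ : Fin d => ℝ) t hB
  set A' := (s.restrict : (Fin d → ℝ) → s → ℝ) ⁻¹' A with hAdef
  set B' := (t.restrict : (Fin d → ℝ) → t → ℝ) ⁻¹' B with hBdef
  have mA : Measurable (A'.indicator (1 : (Fin d → ℝ) → ℝ≥0∞)) := measurable_one.indicator hA'
  have mB : Measurable (B'.indicator (1 : (Fin d → ℝ) → ℝ≥0∞)) := measurable_one.indicator hB'
  have dA : DependsOn (A'.indicator (1 : (Fin d → ℝ) → ℝ≥0∞)) (S : Set (Fin d)) :=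
    (dependsOn_indicator_restrict_preimage s A).mono (Finset.coe_subset.2 hs)
  have dB : DependsOn (B'.indicator (1 : (Fin d → ℝ) → ℝ≥0∞)) (T : Set (Fin d)) :=
    (dependsOn_indicator_restrict_preimage t B).mono (Finset.coe_subset.2 ht)
  have d1 : ∀ v : Set (Fin d), DependsOn (1 : (Fin d → ℝ) → ℝ≥0∞) v := fun v x y _ => rfl
  have kAB := key _ _ mA mB dA dB
  have kA := key _ 1 mA measurable_one dA (d1 _)
  have kB := key 1 _ measurable_one mB (d1 _) dB
  have k1 := key 1 1 measurable_one measurable_one (d1 _) (d1 _)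
  rw [← Set.inter_indicator_one] at kAB
  simp only [one_mul, mul_one] at kA kB k1
  filter_upwards [condProb_eq_lmarginal_div hp hP u (hA'.inter hB'),
    condProb_eq_lmarginal_div hp hP u hA', condProb_eq_lmarginal_div hp hP u hB',
    ae_lmarginal_compl_ne hp hP u] with y e1 e2 e3 e4
  rw [e1, e2, e3, kAB, kA, kB, ← ENNReal.toReal_mul]
  rw [k1] at e4 ⊢
  simp only [Pi.mul_apply] at e4 ⊢
  congr 1
  generalize (∫⋯∫⁻_S, (A'.indicator 1 * g) ∂ν) y = a at *
  generalize (∫⋯∫⁻_T, (B'.indicator 1 * h) ∂ν) y = b at *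
  generalize (∫⋯∫⁻_S, g ∂ν) y = G at *
  generalize (∫⋯∫⁻_T, h ∂ν) y = H at *
  rw [ENNReal.div_eq_inv_mul, ENNReal.div_eq_inv_mul, ENNReal.div_eq_inv_mul]
  calc (G * H)⁻¹ * (a * b) = ((G * H)⁻¹ * (G * H)) * ((G * H)⁻¹ * (a * b)) := by
        rw [ENNReal.inv_mul_cancel e4.1 e4.2, one_mul]
    _ = _ := by ring

end Density

/-! ### The global Markov property -/

namespace ParentGraph

variable {d : ℕ} (G : ParentGraph d)

/-- `i` is an ancestor of `S`: there is a directed path, possibly of length zero, from `i` to some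
node of `S`. -/
inductive Anc (S : Finset (Fin d)) : Fin d → Prop
  | base {i : Fin d} : i ∈ S → Anc S i
  | par {i j : Fin d} : i ∈ G.par j → Anc S j → Anc S i

/-- `W` separates `s` from `t` given `u` in the moral graph of the ancestors of `s ∪ t ∪ u`: it is
the first of two colour classes of the ancestors outside `u`, contains `s`, misses `t`, and no edge
of the moral graph joins nodes of different colours. Edges of the moral graph that come from a
common child outside `u` need not be mentioned, since both parents have the colour of the child. -/
structure IsSeparation (s t u : Finset (Fin d)) (W : Set (Fin d)) : Prop where
  mem_left : ∀ i ∈ s, i ∈ W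
  notMem_right : ∀ i ∈ t, i ∉ W
  arrow : ∀ x y, x ∈ G.par y → x ∉ u → y ∉ u → G.Anc (s ∪ t ∪ u) y → (x ∈ W ↔ y ∈ W)
  collider : ∀ z ∈ u, ∀ x ∈ G.par z, ∀ y ∈ G.par z, x ∉ u → y ∉ u → (x ∈ W ↔ y ∈ W)

/-- The factor of the density that belongs to node `i`, as a function of the whole vector. -/
def factor (f : (i : Fin d) → ℝ → (G.par i → ℝ) → ℝ≥0) (i : Fin d) (y : Fin d → ℝ) : ℝ≥0∞ :=
  f i (y i) ((G.par i).restrict y)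

variable {G} {f : (i : Fin d) → ℝ → (G.par i → ℝ) → ℝ≥0}

theorem measurable_factor (hf : ∀ i, Measurable (Function.uncurry (f i))) (i : Fin d) :
    Measurable (G.factor f i) := by
  have h : Measurable fun y : Fin d → ℝ => (y i, (G.par i).restrict y) :=
    (measurable_pi_apply i).prodMk (Finset.measurable_restrict _)
  exact measurable_coe_nnreal_ennreal.comp ((hf i).comp h)

theorem measurable_prod_factor (hf : ∀ i, Measurable (Function.uncurry (f i)))
    (s : Finset (Fin d)) : Measurable (∏ i ∈ s, G.factor f i) :=
  Finset.prod_induction _ _ (fun _ _ => Measurable.mul) measurable_one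
    fun i _ => measurable_factor hf i

theorem factor_congr {i : Fin d} {x y : Fin d → ℝ} (hi : x i = y i)
    (hp : ∀ j ∈ G.par i, x j = y j) : G.factor f i x = G.factor f i y := by
  have : (G.par i).restrict x = (G.par i).restrict y := funext fun j => hp j j.2
  simp only [factor, hi, this]

theorem notMem_par_self (i : Fin d) : i ∉ G.par i := fun h => lt_irrefl _ (G.lt_of_mem_par i i h)

/-- Integrating the density over a set of nodes whose complement is closed under parents removes
the factors of these nodes. -/
theorem lmarginal_prod_factor {ν : Fin d → Measure ℝ} [∀ i, SigmaFinite (ν i)]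
    (hf : ∀ i, Measurable (Function.uncurry (f i)))
    (hint : ∀ i x, ∫⁻ t, (f i t x : ℝ≥0∞) ∂(ν i) = 1) (N : Finset (Fin d))
    (hN : ∀ i ∉ N, ∀ j ∈ G.par i, j ∉ N) :
    ∫⋯∫⁻_N, (∏ i, G.factor f i) ∂ν = ∏ i ∈ Nᶜ, G.factor f i := by
  induction N using Finset.induction_on_max with
  | empty => simp
  | insert m N hm ih =>
    have hmN : m ∉ N := fun h => lt_irrefl _ (hm m h)
    have hparm : ∀ j ∈ G.par m, j ∉ N := fun j hj hjN =>
      lt_asymm (hm j hjN) (G.lt_of_mem_par m j hj)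
    have hN' : ∀ i ∉ N, ∀ j ∈ G.par i, j ∉ N := by
      intro i hi j hj
      by_cases him : i = m
      · subst him; exact hparm j hj
      · exact fun h => hN i (by simp [him, hi]) j hj (Finset.mem_insert_of_mem h)
    ext x
    rw [lmarginal_insert _ (measurable_prod_factor hf _) hmN, ih hN',
      show Nᶜ = insert m (insert m N)ᶜ by ext i; by_cases h : i = m <;> simp [h, hmN]]
    have h1 : ∀ t, (∏ i ∈ insert m (insert m N)ᶜ, G.factor f i) (Function.update x m t) =
        (f m t ((G.par m).restrict x) : ℝ≥0∞) * (∏ i ∈ (insert m N)ᶜ, G.factor f i) x := by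
      intro t
      rw [Finset.prod_insert (by simp), Pi.mul_apply, Finset.prod_apply, Finset.prod_apply]
      congr 1
      · have : (G.par m).restrict (Function.update x m t) = (G.par m).restrict x :=
          funext fun j => Function.update_of_ne
            (fun h => notMem_par_self m (by have := j.2; rwa [h] at this)) _ _
        simp [factor, this]
      · refine Finset.prod_congr rfl fun i hi => ?_
        rw [Finset.mem_compl] at hi
        refine factor_congr (Function.update_of_ne (fun h => hi (by simp [h])) _ _) fun j hj => ?_
        exact Function.update_of_ne (fun h => hN i hi j hj (by simp [h])) _ _
    simp_rw [h1]
    have h2 : Measurable fun t => (f m t ((G.par m).restrict x) : ℝ≥0∞) :=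
      measurable_coe_nnreal_ennreal.comp ((hf m).comp (measurable_id.prodMk measurable_const))
    rw [lintegral_mul_const _ h2, hint, one_mul]

theorem prod_factor_eq (f : (i : Fin d) → ℝ → (G.par i → ℝ) → ℝ≥0) :
    (fun y => ∏ i, (f i (y i) ((G.par i).restrict y) : ℝ≥0∞)) = ∏ i, G.factor f i := by
  ext y; simp [factor, Finset.prod_apply]

/-- The global Markov property: a separation in the moral graph of the ancestors yields a
conditional independence in every distribution that factorizes over the graph. -/
theorem IsSeparation.implies {s t u : Finset (Fin d)} {W : Set (Fin d)}
    (hW : G.IsSeparation s t u W) (hsu : Disjoint s u) (htu : Disjoint t u) :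
    G.Implies s t u := by
  classical
  rintro P _ ⟨ν, hν, f, hf, hint, hP⟩
  rw [prod_factor_eq] at hP
  set D : Finset (Fin d) := Finset.univ.filter (G.Anc (s ∪ t ∪ u)) with hD
  have memD : ∀ i, i ∈ D ↔ G.Anc (s ∪ t ∪ u) i := fun i => by simp [hD]
  set K : Fin d → Prop := fun i => ∀ j, (j = i ∨ j ∈ G.par i) → j ∉ u → j ∈ W with hK
  set S := D.filter (fun i => i ∉ u ∧ i ∈ W) with hS
  set T := D.filter (fun i => i ∉ u ∧ i ∉ W) with hT
  have hparD : ∀ i ∈ D, ∀ j ∈ G.par i, j ∈ D := fun i hi j hj =>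
    (memD j).2 (Anc.par hj ((memD i).1 hi))
  have huD : ∀ i ∈ u, i ∈ D := fun i hi => (memD i).2 (Anc.base (by simp [hi]))
  -- a node together with its parents has only one colour outside `u`
  have hnotK : ∀ i ∈ D, ¬ K i → ∀ j, (j = i ∨ j ∈ G.par i) → j ∉ u → j ∉ W := by
    intro i hi hKi j hj hju hjW
    refine hKi fun k hk hku => ?_
    by_cases hiu : i ∈ u
    · have hj' : j ∈ G.par i := hj.resolve_left fun h => hju (h ▸ hiu)
      have hk' : k ∈ G.par i := hk.resolve_left fun h => hku (h ▸ hiu)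
      exact (hW.collider i hiu j hj' k hk' hju hku).1 hjW
    · have col : ∀ l, (l = i ∨ l ∈ G.par i) → l ∉ u → (l ∈ W ↔ i ∈ W) := by
        rintro l (rfl | hl) hlu
        · rfl
        · exact hW.arrow l i hl hlu hiu ((memD i).1 hi)
      exact (col k hk hku).2 ((col j hj hju).1 hjW)
  have hmarg := lmarginal_prod_factor (ν := ν) hf hint Dᶜ
    (fun i hi j hj => by simpa using hparD i (by simpa using hi) j hj)
  rw [compl_compl, ← Finset.prod_filter_mul_prod_filter_not D K] at hmarg
  refine condIndepNodes_of_lmarginal_eq_mul (S := S) (T := T) (u := u) (N := Dᶜ)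
    (measurable_prod_factor hf _) hP ?_ ?_ ?_ ?_ (measurable_prod_factor hf _)
    (measurable_prod_factor hf _) ?_ ?_ hmarg ?_ ?_
  · exact Finset.disjoint_left.2 fun i hi hi' => by simp_all
  · exact Finset.disjoint_left.2 fun i hi hi' => by simp_all
  · exact Finset.disjoint_left.2 fun i hi hi' => by simp_all
  · ext i
    have := huD i
    simp only [hS, hT, Finset.mem_compl, Finset.mem_union, Finset.mem_filter]
    tauto
  · intro x y hxy
    rw [Finset.prod_apply, Finset.prod_apply]
    refine Finset.prod_congr rfl fun i hi => ?_
    obtain ⟨hiD, hKi⟩ := Finset.mem_filter.1 hi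
    have key : ∀ j, (j = i ∨ j ∈ G.par i) → x j = y j := fun j hj => hxy j (by
      have hjD : j ∈ D := hj.elim (fun h => h ▸ hiD) (hparD i hiD j)
      have := hKi j hj
      simp only [Finset.coe_union, Set.mem_union, Finset.mem_coe, hS, Finset.mem_filter]
      tauto)
    exact factor_congr (key i (Or.inl rfl)) fun j hj => key j (Or.inr hj)
  · intro x y hxy
    rw [Finset.prod_apply, Finset.prod_apply]
    refine Finset.prod_congr rfl fun i hi => ?_
    obtain ⟨hiD, hKi⟩ := Finset.mem_filter.1 hi
    have key : ∀ j, (j = i ∨ j ∈ G.par i) → x j = y j := fun j hj => hxy j (by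
      have hjD : j ∈ D := hj.elim (fun h => h ▸ hiD) (hparD i hiD j)
      have := hnotK i hiD hKi j hj
      simp only [Finset.coe_union, Set.mem_union, Finset.mem_coe, hT, Finset.mem_filter]
      tauto)
    exact factor_congr (key i (Or.inl rfl)) fun j hj => key j (Or.inr hj)
  · intro i hi
    exact Finset.mem_filter.2 ⟨(memD i).2 (Anc.base (by simp [hi])),
      Finset.disjoint_left.1 hsu hi, hW.mem_left i hi⟩
  · intro i hi
    exact Finset.mem_filter.2 ⟨(memD i).2 (Anc.base (by simp [hi])),
      Finset.disjoint_left.1 htu hi, hW.notMem_right i hi⟩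

end ParentGraph

/-! ### Completeness: the consensus model -/

/-- Under conditional independence, two events that are both compatible with a fixed value of the
conditioning vector are also jointly compatible with it. -/
theorem CondIndepNodes.measure_inter_ne_zero {d : ℕ} {P : Measure (Fin d → ℝ)}
    [IsProbabilityMeasure P] {s t u : Finset (Fin d)} (h : CondIndepNodes P s t u)
    {A : Set (s → ℝ)} {B : Set (t → ℝ)} (hA : MeasurableSet A) (hB : MeasurableSet B) (e : u → ℝ)
    (hAE : P (s.restrict ⁻¹' A ∩ u.restrict ⁻¹' {e}) ≠ 0)
    (hBE : P (t.restrict ⁻¹' B ∩ u.restrict ⁻¹' {e}) ≠ 0) :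
    P (s.restrict ⁻¹' A ∩ t.restrict ⁻¹' B ∩ u.restrict ⁻¹' {e}) ≠ 0 := by
  intro h0
  have hci := (condIndepFun_iff_condExp_inter_preimage_eq_mul
    (Finset.measurable_restrict s) (Finset.measurable_restrict t)).1 h A B hA hB
  have hA' := Finset.measurable_restrict (X := fun _ : Fin d => ℝ) s hA
  have hB' := Finset.measurable_restrict (X := fun _ : Fin d => ℝ) t hB
  have hm : MeasurableSpace.comap (u.restrict : (Fin d → ℝ) → u → ℝ) inferInstance ≤
    MeasurableSpace.pi := (Finset.measurable_restrict u).comap_le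
  set A' := (s.restrict : (Fin d → ℝ) → s → ℝ) ⁻¹' A
  set B' := (t.restrict : (Fin d → ℝ) → t → ℝ) ⁻¹' B
  set E := (u.restrict : (Fin d → ℝ) → u → ℝ) ⁻¹' {e} with hE
  have hEm : MeasurableSet[MeasurableSpace.comap (u.restrict : (Fin d → ℝ) → u → ℝ)
    inferInstance] E := ⟨{e}, measurableSet_singleton e, rfl⟩
  obtain ⟨y₀, -, hy₀⟩ := nonempty_of_measure_ne_zero hAE
  -- conditional expectations given `Y_u` are constant on the event `Y_u = e`
  have hconst : ∀ φ : (Fin d → ℝ) → ℝ, ∀ y ∈ E,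
      (P[φ | MeasurableSpace.comap (u.restrict : (Fin d → ℝ) → u → ℝ) inferInstance]) y =
      (P[φ | MeasurableSpace.comap (u.restrict : (Fin d → ℝ) → u → ℝ) inferInstance]) y₀ := by
    intro φ y hy
    obtain ⟨C, -, hC⟩ := (stronglyMeasurable_condExp (μ := P) (f := φ)
      (m := MeasurableSpace.comap (u.restrict : (Fin d → ℝ) → u → ℝ) inferInstance)).measurable
      (measurableSet_singleton ((P[φ | MeasurableSpace.comap
        (u.restrict : (Fin d → ℝ) → u → ℝ) inferInstance]) y₀))
    have h1 : u.restrict y = u.restrict y₀ := by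
      have e1 : u.restrict y = e := hy
      have e2 : u.restrict y₀ = e := hy₀
      rw [e1, e2]
    have h2 : y₀ ∈ (u.restrict : (Fin d → ℝ) → u → ℝ) ⁻¹' C := by rw [hC]; rfl
    have h3 : y ∈ (u.restrict : (Fin d → ℝ) → u → ℝ) ⁻¹' C := by
      rw [Set.mem_preimage] at h2 ⊢; rwa [h1]
    rw [hC] at h3
    exact h3
  have hval : ∀ F : Set (Fin d → ℝ), MeasurableSet F →
      P.real E * (P⟦F | MeasurableSpace.comap (u.restrict : (Fin d → ℝ) → u → ℝ)
        inferInstance⟧) y₀ = P.real (F ∩ E) := by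
    intro F hF
    have h1 := setIntegral_condExp (μ := P) hm ((integrable_const (1 : ℝ)).indicator hF) hEm
    rw [setIntegral_congr_fun (hm E hEm) (hconst _), setIntegral_const,
      setIntegral_indicator hF, setIntegral_const] at h1
    simpa [Set.inter_comm] using h1
  have hab : (P⟦A' ∩ B' | MeasurableSpace.comap (u.restrict : (Fin d → ℝ) → u → ℝ)
        inferInstance⟧) y₀ = (P⟦A' | MeasurableSpace.comap (u.restrict : (Fin d → ℝ) → u → ℝ)
        inferInstance⟧) y₀ * (P⟦B' | MeasurableSpace.comap (u.restrict : (Fin d → ℝ) → u → ℝ)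
        inferInstance⟧) y₀ := by
    have hEpos : P E ≠ 0 := fun h => hAE (measure_mono_null Set.inter_subset_right h)
    obtain ⟨y, hy, hyE⟩ : ∃ y, _ ∧ y ∈ E :=
      ((frequently_ae_mem_iff.2 hEpos).and_eventually hci).exists.imp fun y hy => ⟨hy.2, hy.1⟩
    simpa only [hconst _ y hyE] using hy
  have hz := hval _ (hA'.inter hB')
  rw [hab, (measureReal_eq_zero_iff (by finiteness)).2 h0] at hz
  have ha := hval _ hA'
  have hb := hval _ hB'
  have hA0 : P.real (A' ∩ E) ≠ 0 := by rwa [Ne, measureReal_eq_zero_iff]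
  have hB0 : P.real (B' ∩ E) ≠ 0 := by rwa [Ne, measureReal_eq_zero_iff]
  rw [← ha] at hA0
  rw [← hb] at hB0
  have hE0 := left_ne_zero_of_mul hA0
  exact mul_ne_zero hE0 (mul_ne_zero (right_ne_zero_of_mul hA0) (right_ne_zero_of_mul hB0)) hz

namespace ParentGraph

variable {d : ℕ} (G : ParentGraph d) (u : Finset (Fin d))

/-- All parents of `i` outside `u` have the value `v`. -/
def ParentsAgree (i : Fin d) (v : ℝ) (x : G.par i → ℝ) : Prop :=
  ∀ j : G.par i, (j : Fin d) ∉ u → x j = v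

open Classical in
/-- Conditional probability of the value `0` at node `i` in the consensus model for `u`. -/
noncomputable def consensusZero (i : Fin d) (x : G.par i → ℝ) : ℝ≥0 :=
  if i ∈ u then if G.ParentsAgree u i 0 x ∨ G.ParentsAgree u i 1 x then 1 else 0
  else if G.ParentsAgree u i 0 x then 2⁻¹ else 0

open Classical in
/-- Conditional probability of the value `1` at node `i` in the consensus model for `u`. -/
noncomputable def consensusOne (i : Fin d) (x : G.par i → ℝ) : ℝ≥0 :=
  if i ∈ u then 0 else if G.ParentsAgree u i 1 x then 2⁻¹ else 0

open Classical in
/-- Conditional densities of the consensus model for `u`, in which the variables take the values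
`0`, `1`, `2`. A node outside `u` can be `0` only if all its parents outside `u` are `0`, and `1`
only if they all are `1`. A node in `u` reports by the value `0` that its parents outside `u` are
all `0` or all `1`. In every other case the value is `2`. -/
noncomputable def consensusDensity (i : Fin d) (t : ℝ) (x : G.par i → ℝ) : ℝ≥0 :=
  if t = 0 then G.consensusZero u i x
  else if t = 1 then G.consensusOne u i x
  else 1 - (G.consensusZero u i x + G.consensusOne u i x)

/-- The reference measure of the consensus model: counting measure on `{0, 1, 2}`. -/
noncomputable def consensusBase : Measure ℝ :=
  Measure.dirac 0 + Measure.dirac 1 + Measure.dirac 2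

instance : IsFiniteMeasure consensusBase := by unfold consensusBase; infer_instance

/-- The consensus model for `u`. -/
noncomputable def consensusModel : Measure (Fin d → ℝ) :=
  (Measure.pi fun _ => consensusBase).withDensity (∏ i, G.factor (G.consensusDensity u) i)

variable {G u}

theorem consensus_add_le (i : Fin d) (x : G.par i → ℝ) :
    G.consensusZero u i x + G.consensusOne u i x ≤ 1 := by
  have h : (2⁻¹ : ℝ≥0) + 2⁻¹ = 1 := by
    rw [← NNReal.coe_inj]; push_cast; norm_num
  have h' : (2⁻¹ : ℝ≥0) ≤ 1 := by rw [← h]; exact le_self_add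
  unfold consensusZero consensusOne
  split_ifs <;> simp [h, h']

theorem measurableSet_parentsAgree (i : Fin d) (v : ℝ) :
    MeasurableSet {x : G.par i → ℝ | G.ParentsAgree u i v x} := by
  have : {x : G.par i → ℝ | G.ParentsAgree u i v x} =
      ⋂ j : G.par i, ⋂ _ : (j : Fin d) ∉ u, {x | x j = v} := by
    ext x; simp [ParentsAgree]
  rw [this]
  exact MeasurableSet.iInter fun j => MeasurableSet.iInter fun _ =>
    measurableSet_eq_fun (measurable_pi_apply j) measurable_const

theorem measurable_consensusZero (i : Fin d) : Measurable (G.consensusZero u i) := by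
  unfold consensusZero
  exact Measurable.ite (MeasurableSet.const _)
    (Measurable.ite ((measurableSet_parentsAgree i 0).union (measurableSet_parentsAgree i 1))
      measurable_const measurable_const)
    (Measurable.ite (measurableSet_parentsAgree i 0) measurable_const measurable_const)

theorem measurable_consensusOne (i : Fin d) : Measurable (G.consensusOne u i) := by
  unfold consensusOne
  exact Measurable.ite (MeasurableSet.const _) measurable_const
    (Measurable.ite (measurableSet_parentsAgree i 1) measurable_const measurable_const)

theorem measurable_consensusDensity (i : Fin d) :
    Measurable (Function.uncurry (G.consensusDensity u i)) := by
  have h0 : Measurable fun p : ℝ × (G.par i → ℝ) => G.consensusZero u i p.2 :=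
    (measurable_consensusZero i).comp measurable_snd
  have h1 : Measurable fun p : ℝ × (G.par i → ℝ) => G.consensusOne u i p.2 :=
    (measurable_consensusOne i).comp measurable_snd
  exact Measurable.ite (measurable_fst (measurableSet_singleton 0)) h0
    (Measurable.ite (measurable_fst (measurableSet_singleton 1)) h1
      (measurable_const.sub (h0.add h1)))

theorem lintegral_consensusDensity (i : Fin d) (x : G.par i → ℝ) :
    ∫⁻ t, (G.consensusDensity u i t x : ℝ≥0∞) ∂consensusBase = 1 := by
  rw [consensusBase, lintegral_add_measure, lintegral_add_measure, lintegral_dirac,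
    lintegral_dirac, lintegral_dirac]
  simp only [consensusDensity, if_true, one_ne_zero, if_false, OfNat.ofNat_ne_zero,
    OfNat.ofNat_ne_one]
  rw [← ENNReal.coe_add, ← ENNReal.coe_add, add_tsub_cancel_of_le (consensus_add_le i x),
    ENNReal.coe_one]

instance : IsProbabilityMeasure (G.consensusModel u) := ⟨by
  have h := lmarginal_prod_factor (G := G) (ν := fun _ => consensusBase)
    (measurable_consensusDensity (u := u)) lintegral_consensusDensity Finset.univ (by simp)
  rw [consensusModel, withDensity_apply _ MeasurableSet.univ, Measure.restrict_univ,
    lintegral_eq_lmarginal_univ (0 : Fin d → ℝ), h]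
  simp⟩

theorem factorizes_consensusModel : G.Factorizes (G.consensusModel u) :=
  ⟨fun _ => consensusBase, fun _ => inferInstance, G.consensusDensity u,
    measurable_consensusDensity, lintegral_consensusDensity, by
      rw [prod_factor_eq]; rfl⟩

theorem consensusModel_singleton_ne_zero {y : Fin d → ℝ} (hy : ∀ i, y i = 0 ∨ y i = 1)
    (h : ∀ i, G.consensusDensity u i (y i) ((G.par i).restrict y) ≠ 0) :
    G.consensusModel u {y} ≠ 0 := by
  rw [consensusModel, withDensity_apply _ (measurableSet_singleton y), lintegral_singleton,
    Measure.pi_singleton, Finset.prod_apply]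
  refine mul_ne_zero (Finset.prod_ne_zero_iff.2 fun i _ => ?_)
    (Finset.prod_ne_zero_iff.2 fun i _ => ?_)
  · simpa [factor] using h i
  · rcases hy i with hi | hi <;> simp [hi, consensusBase]

theorem ae_consensusDensity_ne_zero : ∀ᵐ y ∂(G.consensusModel u),
    ∀ i, G.consensusDensity u i (y i) ((G.par i).restrict y) ≠ 0 := by
  rw [consensusModel, ae_withDensity_iff (measurable_prod_factor measurable_consensusDensity _)]
  refine ae_of_all _ fun y hy i => ?_
  rw [Finset.prod_apply, Finset.prod_ne_zero_iff] at hy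
  simpa [factor] using hy i (Finset.mem_univ i)

/-- A possible outcome of the consensus model with `Y_s = 0`, `Y_t = 1` and `Y_u = 0` is a
separation: colour the nodes by their values. -/
theorem isSeparation_of_consensus {s t : Finset (Fin d)} {y : Fin d → ℝ}
    (hy : ∀ i, G.consensusDensity u i (y i) ((G.par i).restrict y) ≠ 0)
    (hs : ∀ i ∈ s, y i = 0) (ht : ∀ i ∈ t, y i = 1) (hu : ∀ i ∈ u, y i = 0) :
    G.IsSeparation s t u {i | y i = 0} := by
  have h0 : ∀ i ∉ u, y i = 0 → ∀ j ∈ G.par i, j ∉ u → y j = 0 := by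
    intro i hi hyi j hj hju
    by_contra hne
    refine hy i ?_
    have : ¬ G.ParentsAgree u i 0 ((G.par i).restrict y) := fun h => hne (h ⟨j, hj⟩ hju)
    simp [consensusDensity, consensusZero, hyi, hi, this]
  have h1 : ∀ i ∉ u, y i = 1 → ∀ j ∈ G.par i, j ∉ u → y j = 1 := by
    intro i hi hyi j hj hju
    by_contra hne
    refine hy i ?_
    have : ¬ G.ParentsAgree u i 1 ((G.par i).restrict y) := fun h => hne (h ⟨j, hj⟩ hju)
    simp [consensusDensity, consensusOne, hyi, hi, this]
  have h2 : ∀ i ∈ u, (∀ j ∈ G.par i, j ∉ u → y j = 0) ∨ (∀ j ∈ G.par i, j ∉ u → y j = 1) := by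
    intro i hi
    by_contra hne
    rw [not_or] at hne
    refine hy i ?_
    have h0 : ¬ G.ParentsAgree u i 0 ((G.par i).restrict y) := fun h =>
      hne.1 fun j hj hju => h ⟨j, hj⟩ hju
    have h1 : ¬ G.ParentsAgree u i 1 ((G.par i).restrict y) := fun h =>
      hne.2 fun j hj hju => h ⟨j, hj⟩ hju
    simp [consensusDensity, consensusZero, hu i hi, hi, h0, h1]
  have hval : ∀ i, G.Anc (s ∪ t ∪ u) i → i ∉ u → y i = 0 ∨ y i = 1 := by
    intro i hi
    induction hi with
    | base h =>
      intro hiu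
      simp only [Finset.mem_union, hiu, or_false] at h
      exact h.imp (hs _) (ht _)
    | @par i j hij _ ih =>
      intro hiu
      by_cases hju : j ∈ u
      · exact (h2 j hju).imp (fun h => h i hij hiu) (fun h => h i hij hiu)
      · exact (ih hju).imp (fun h => h0 j hju h i hij hiu) (fun h => h1 j hju h i hij hiu)
  refine ⟨hs, fun i hi h => ?_, fun x z hx hxu hzu hz => ?_, fun z hz x hx w hw hxu hwu => ?_⟩
  · have h' : y i = 0 := h
    rw [ht i hi] at h'
    exact one_ne_zero h'
  · change y x = 0 ↔ y z = 0
    rcases hval z hz hzu with h | h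
    · simp [h, h0 z hzu h x hx hxu]
    · simp [h, h1 z hzu h x hx hxu]
  · change y x = 0 ↔ y w = 0
    rcases h2 z hz with h | h <;> simp [h x hx hxu, h w hw hwu]

/-- Completeness: an independence that the graph implies comes from a separation. -/
theorem Implies.exists_isSeparation {s t : Finset (Fin d)} (h : G.Implies s t u)
    (htu : Disjoint t u) : ∃ W, G.IsSeparation s t u W := by
  by_contra hno
  have hci := h (G.consensusModel u) factorizes_consensusModel
  refine hci.measure_inter_ne_zero (measurableSet_singleton 0) (measurableSet_singleton 1) 0
    ?_ ?_ ?_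
  · refine fun h0 => consensusModel_singleton_ne_zero (G := G) (u := u) (y := 0)
      (fun i => Or.inl rfl) (fun i => ?_) (measure_mono_null ?_ h0)
    · have : G.ParentsAgree u i 0 ((G.par i).restrict (0 : Fin d → ℝ)) :=
        fun j _ => rfl
      by_cases hi : i ∈ u <;> simp [consensusDensity, consensusZero, hi, this]
    · rintro _ rfl
      exact ⟨rfl, rfl⟩
  · classical
    refine fun h0 => consensusModel_singleton_ne_zero (G := G) (u := u)
      (y := fun i => if i ∈ u then 0 else 1)
      (fun i => by by_cases hi : i ∈ u <;> simp [hi]) (fun i => ?_) (measure_mono_null ?_ h0)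
    · have : G.ParentsAgree u i 1 ((G.par i).restrict (fun i => if i ∈ u then (0 : ℝ) else 1)) :=
        fun j hj => by simp [hj]
      by_cases hi : i ∈ u <;>
        simp [consensusDensity, consensusZero, consensusOne, hi, this]
    · rintro _ rfl
      refine ⟨funext fun i => ?_, funext fun i => ?_⟩
      · simp [Finset.disjoint_left.1 htu i.2]
      · simp
  · rw [measure_eq_zero_iff_ae_notMem]
    filter_upwards [ae_consensusDensity_ne_zero (G := G) (u := u)] with y hy
    rintro ⟨⟨hs, ht⟩, hu⟩
    exact hno ⟨_, isSeparation_of_consensus hy (fun i hi => congrFun hs ⟨i, hi⟩)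
      (fun i hi => congrFun ht ⟨i, hi⟩) (fun i hi => congrFun hu ⟨i, hi⟩)⟩

theorem implies_iff_exists_isSeparation {s t : Finset (Fin d)} (hsu : Disjoint s u)
    (htu : Disjoint t u) : G.Implies s t u ↔ ∃ W, G.IsSeparation s t u W :=
  ⟨fun h => h.exists_isSeparation htu, fun ⟨_, hW⟩ => hW.implies hsu htu⟩

end ParentGraph

/-! ### Partial closure and paths -/

namespace EdgeMatrix

variable {d : ℕ}

/-- There is an `r`-path of length at least one from `i` to `j` with all inner nodes in `s`. -/
inductive Through (s : Set (Fin d)) (r : Fin d → Fin d → Prop) (i : Fin d) : Fin d → Prop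
  | base {j : Fin d} : r i j → Through s r i j
  | step {k j : Fin d} : Through s r i k → k ∈ s → r k j → Through s r i j

theorem Through.trans {s : Set (Fin d)} {r : Fin d → Fin d → Prop} {i k j : Fin d}
    (h₁ : Through s r i k) (hk : k ∈ s) (h₂ : Through s r k j) : Through s r i j := by
  induction h₂ with
  | base h => exact h₁.step hk h
  | step _ hm h ih => exact ih.step hm h

/-- With ones on the diagonal, the special treatment of the row and the column of the pivot `k` is
absorbed by the general rule. -/
theorem zerStep_eq_one_iff {X : Matrix (Fin d) (Fin d) ℕ} (hX : ∀ i, X i i = 1)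
    (k i j : Fin d) : zerStep k X i j = 1 ↔ X i j = 1 ∨ X i k = 1 ∧ X k j = 1 := by
  have := hX k
  simp only [zerStep, Matrix.of_apply, mul_eq_one]
  split_ifs <;> aesop

theorem foldl_zerStep_eq_one_iff (l : List (Fin d)) {X : Matrix (Fin d) (Fin d) ℕ}
    (hX : ∀ i, X i i = 1) (i j : Fin d) :
    l.foldl (fun Y k => zerStep k Y) X i j = 1 ↔
      Through {k | k ∈ l} (fun i j => X i j = 1) i j := by
  induction l generalizing X i j with
  | nil =>
    refine ⟨fun h => .base h, fun h => ?_⟩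
    cases h with
    | base h => exact h
    | step _ hk _ => simp at hk
  | cons k l ih =>
    have hz := zerStep_eq_one_iff hX k
    rw [List.foldl_cons, ih fun i => (hz i i).2 (Or.inl (hX i))]
    constructor
    · intro h
      induction h with
      | base h =>
        rcases (hz _ _).1 h with h | ⟨h, h'⟩
        · exact .base h
        · exact (Through.base h).step (by simp) h'
      | step _ hm h ih' =>
        have hm' : _ ∈ {m | m ∈ k :: l} := List.mem_cons_of_mem k hm
        rcases (hz _ _).1 h with h | ⟨h, h'⟩
        · exact ih'.step hm' h
        · exact (ih'.step hm' h).step (by simp) h'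
    · intro h
      induction h with
      | base h => exact .base ((hz _ _).2 (Or.inl h))
      | @step m j _ hm h ih' =>
        rcases List.mem_cons.1 hm with rfl | hm
        · -- the last arrow into the pivot is an arrow of the original matrix
          have hpiv : ∀ a, zerStep m X a m = 1 → zerStep m X a j = 1 := fun a ha =>
            (hz a j).2 (Or.inr ⟨((hz a m).1 ha).elim id And.left, h⟩)
          cases ih' with
          | base h' => exact .base (hpiv _ h')
          | step h₁ hk h' => exact h₁.step hk (hpiv _ h')
        · exact ih'.step hm ((hz _ _).2 (Or.inl h))

theorem zer_le_one (s : Finset (Fin d)) {X : Matrix (Fin d) (Fin d) ℕ} (hX : ∀ i j, X i j ≤ 1)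
    (i j : Fin d) : zer s X i j ≤ 1 := by
  rw [zer]
  generalize s.sort (· ≤ ·) = l
  induction l generalizing X with
  | nil => exact hX i j
  | cons k l ih =>
    refine ih fun i j => ?_
    simp only [zerStep, Matrix.of_apply]
    split_ifs <;> simp [hX]

/-- The nonzero entries of a partial closure are given by the paths with inner nodes in `s`. -/
theorem zer_ne_zero_iff (s : Finset (Fin d)) {X : Matrix (Fin d) (Fin d) ℕ}
    (hX : ∀ i j, X i j ≤ 1) (hdiag : ∀ i, X i i ≠ 0) (i j : Fin d) :
    zer s X i j ≠ 0 ↔ Through s (fun i j => X i j ≠ 0) i j := by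
  have h1 : ∀ n : ℕ, n ≤ 1 → (n ≠ 0 ↔ n = 1) := by omega
  rw [h1 _ (zer_le_one s hX i j), zer,
    foldl_zerStep_eq_one_iff _ fun i => (h1 _ (hX i i)).1 (hdiag i)]
  simp only [h1 _ (hX _ _), Finset.mem_sort]
  rfl

theorem ind_apply_eq_zero_iff {m n : Type*} (X : Matrix m n ℕ) (i : m) (j : n) :
    ind X i j = 0 ↔ X i j = 0 := by
  simp [ind]

theorem ind_le_one {m n : Type*} (X : Matrix m n ℕ) (i : m) (j : n) : ind X i j ≤ 1 := by
  simp only [ind, Matrix.of_apply]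
  split_ifs <;> simp

end EdgeMatrix

namespace ParentGraph

open EdgeMatrix

variable {d : ℕ} (G : ParentGraph d) (a : Finset (Fin d))

/-- `j` equals `i` or is an ancestor of `i` along a directed path with inner nodes in `a`. -/
def LineAnc (i j : Fin d) : Prop := G.matB a i j ≠ 0

/-- The nonzero entries of `ℋ`. -/
def ColliderLink (i j : Fin d) : Prop := G.matH a i j ≠ 0

variable {G a}

theorem lineAnc_iff {i j : Fin d} :
    G.LineAnc a i j ↔ Through a (fun i j => j ∈ G.par i ∨ i = j) i j := by
  rw [LineAnc, matB, zer_ne_zero_iff]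
  · simp only [edgeMatrix, Matrix.of_apply, ne_eq, ite_eq_right_iff, one_ne_zero, imp_false,
      not_not]
  · intro i j; simp only [edgeMatrix, Matrix.of_apply]; split_ifs <;> simp
  · simp [edgeMatrix]

theorem LineAnc.refl (i : Fin d) : G.LineAnc a i i := lineAnc_iff.2 (.base (Or.inr rfl))

theorem LineAnc.of_par {i j : Fin d} (h : j ∈ G.par i) : G.LineAnc a i j :=
  lineAnc_iff.2 (.base (Or.inl h))

theorem LineAnc.trans {i k j : Fin d} (h₁ : G.LineAnc a i k) (hk : k ∈ a)
    (h₂ : G.LineAnc a k j) : G.LineAnc a i j :=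
  lineAnc_iff.2 ((lineAnc_iff.1 h₁).trans hk (lineAnc_iff.1 h₂))

theorem LineAnc.anc {S : Finset (Fin d)} {i j : Fin d} (h : G.LineAnc a i j) (hi : G.Anc S i) :
    G.Anc S j := by
  rw [lineAnc_iff] at h
  induction h with
  | base h => rcases h with h | rfl; exacts [.par h hi, hi]
  | step _ _ h ih => rcases h with h | rfl; exacts [.par h ih, ih]

/-- Follow a directed path from an ancestor of `S` up to the first node outside `a`. -/
theorem Anc.exists_lineAnc {S : Finset (Fin d)} (hS : ∀ x ∉ a, x ∈ S) {i : Fin d}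
    (h : G.Anc S i) : ∃ e ∈ S, G.LineAnc a e i := by
  induction h with
  | base h => exact ⟨_, h, .refl _⟩
  | @par i j hij _ ih =>
    obtain ⟨e, he, hej⟩ := ih
    by_cases hj : j ∈ a
    · exact ⟨e, he, hej.trans hj (.of_par hij)⟩
    · exact ⟨j, hS j hj, .of_par hij⟩

theorem preH_ne_zero_iff (i j : Fin d) : G.preH a i j ≠ 0 ↔
    i = j ∨ (i ∈ a ∧ j ∉ a ∧ G.LineAnc a j i) ∨ (i ∉ a ∧ j ∈ a ∧ G.LineAnc a i j) ∨
      (i ∉ a ∧ j ∉ a ∧ ∃ h ∈ a, G.LineAnc a i h ∧ G.LineAnc a j h) := by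
  simp only [preH, Matrix.of_apply, LineAnc]
  by_cases hi : i ∈ a <;> by_cases hj : j ∈ a
  · simp [hi, hj, Matrix.one_apply]
  · have : i ≠ j := fun h => hj (h ▸ hi)
    simp [hi, hj, this]
  · have : i ≠ j := fun h => hi (h ▸ hj)
    simp [hi, hj, this]
  · simp [hi, hj, Matrix.one_apply]
    tauto

theorem colliderLink_iff {i j : Fin d} : G.ColliderLink a i j ↔
    Through ((aᶜ : Finset (Fin d)) : Set (Fin d)) (fun i j => G.preH a i j ≠ 0) i j := by
  rw [ColliderLink, matH, zer_ne_zero_iff]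
  · simp only [ne_eq, ind_apply_eq_zero_iff]
  · exact ind_le_one _
  · intro i
    rw [ne_eq, ind_apply_eq_zero_iff, ← ne_eq, preH_ne_zero_iff]
    exact Or.inl rfl

theorem ColliderLink.refl (i : Fin d) : G.ColliderLink a i i :=
  colliderLink_iff.2 (.base ((preH_ne_zero_iff _ _).2 (Or.inl rfl)))

theorem ColliderLink.trans {i k j : Fin d} (h₁ : G.ColliderLink a i k) (hk : k ∉ a)
    (h₂ : G.ColliderLink a k j) : G.ColliderLink a i j :=
  colliderLink_iff.2 ((colliderLink_iff.1 h₁).trans (by simpa using hk) (colliderLink_iff.1 h₂))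

theorem LineAnc.colliderLink_left {x g : Fin d} (h : G.LineAnc a x g) (hx : x ∉ a) (hg : g ∈ a) :
    G.ColliderLink a g x :=
  colliderLink_iff.2 (.base ((preH_ne_zero_iff _ _).2 (Or.inr (Or.inl ⟨hg, hx, h⟩))))

theorem LineAnc.colliderLink_right {x g : Fin d} (h : G.LineAnc a x g) (hx : x ∉ a) (hg : g ∈ a) :
    G.ColliderLink a x g :=
  colliderLink_iff.2 (.base ((preH_ne_zero_iff _ _).2 (Or.inr (Or.inr (Or.inl ⟨hx, hg, h⟩)))))

theorem ColliderLink.of_common {x y g : Fin d} (hx : x ∉ a) (hy : y ∉ a) (hg : g ∈ a)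
    (h₁ : G.LineAnc a x g) (h₂ : G.LineAnc a y g) : G.ColliderLink a x y :=
  colliderLink_iff.2 (.base ((preH_ne_zero_iff _ _).2
    (Or.inr (Or.inr (Or.inr ⟨hx, hy, g, hg, h₁, h₂⟩)))))

/-- A property is constant along the links of `ℋ` if it is passed between every node outside `a`
and its ancestors in `a`. -/
theorem ColliderLink.iff_of_lineAnc {Q : Fin d → Prop}
    (hQ : ∀ x ∉ a, ∀ g ∈ a, G.LineAnc a x g → (Q x ↔ Q g)) {i j : Fin d}
    (h : G.ColliderLink a i j) : Q i ↔ Q j := by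
  have step : ∀ i j, G.preH a i j ≠ 0 → (Q i ↔ Q j) := by
    intro i j h
    rcases (preH_ne_zero_iff i j).1 h with
      rfl | ⟨hi, hj, h⟩ | ⟨hi, hj, h⟩ | ⟨hi, hj, g, hg, h₁, h₂⟩
    · rfl
    · exact (hQ j hj i hi h).symm
    · exact hQ i hi j hj h
    · exact (hQ i hi g hg h₁).trans (hQ j hj g hg h₂).symm
  rw [colliderLink_iff] at h
  induction h with
  | base h => exact step _ _ h
  | step _ _ h ih => exact ih.trans (step _ _ h)

/-! ### Separations and the induced edge matrices -/

theorem inducedP_eq_zero_iff {M α β C : Finset (Fin d)} : G.inducedP M α β C = 0 ↔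
    ∀ i ∈ α, ∀ j ∈ β, ¬ G.LineAnc (α ∪ M) i j ∧
      ∀ h ∈ α ∪ M, ∀ c ∈ β ∪ C, G.LineAnc (α ∪ M) i h → G.ColliderLink (α ∪ M) h c →
        ¬ G.LineAnc (α ∪ M) c j := by
  rw [← Matrix.ext_iff]
  simp only [inducedP, edgeP, Matrix.submatrix_apply, ind_apply_eq_zero_iff, block,
    Matrix.add_apply, Matrix.mul_apply, Nat.add_eq_zero_iff,
    Finset.sum_eq_zero_iff, mul_eq_zero, Finset.mem_univ, true_implies, Subtype.forall,
    Matrix.zero_apply, LineAnc, ColliderLink]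
  grind

theorem inducedCov_eq_zero_iff {M α : Finset (Fin d)} : G.inducedCov M α = 0 ↔
    ∀ i ∈ α, ∀ j ∈ M, ∀ h ∈ α ∪ M, ∀ h' ∈ α ∪ M, G.LineAnc (α ∪ M) i h →
      G.ColliderLink (α ∪ M) h h' → ¬ G.LineAnc (α ∪ M) j h' := by
  rw [← Matrix.ext_iff]
  simp only [inducedCov, edgeCov, Matrix.submatrix_apply, ind_apply_eq_zero_iff, block,
    Matrix.mul_apply, Matrix.transpose_apply,
    Finset.sum_eq_zero_iff, mul_eq_zero, Finset.mem_univ, true_implies, Subtype.forall,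
    Matrix.zero_apply, LineAnc, ColliderLink]
  grind

theorem inducedCon_eq_zero_iff {M α β C : Finset (Fin d)} : G.inducedCon M α β C = 0 ↔
    ∀ i ∈ β, ∀ j ∈ C, ∀ c ∈ β ∪ C, ∀ c' ∈ β ∪ C, G.LineAnc (α ∪ M) c i →
      G.ColliderLink (α ∪ M) c c' → ¬ G.LineAnc (α ∪ M) c' j := by
  rw [← Matrix.ext_iff]
  simp only [inducedCon, edgeCon, Matrix.submatrix_apply, ind_apply_eq_zero_iff, block,
    Matrix.mul_apply, Matrix.transpose_apply,
    Finset.sum_eq_zero_iff, mul_eq_zero, Finset.mem_univ, true_implies, Subtype.forall,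
    Matrix.zero_apply, LineAnc, ColliderLink]
  grind

/-- The colour of a node, where a node of `u` gets the colour of its parents outside `u`. -/
def Coloured (G : ParentGraph d) (u : Finset (Fin d)) (W : Set (Fin d)) (x : Fin d) : Prop :=
  (x ∉ u ∧ x ∈ W) ∨ (x ∈ u ∧ ∃ p ∈ G.par x, p ∉ u ∧ p ∈ W)

/-- The colour of a separation does not change along directed paths whose inner nodes avoid `u`. -/
theorem IsSeparation.coloured_iff_of_lineAnc {s t u : Finset (Fin d)} {W : Set (Fin d)}
    (hW : G.IsSeparation s t u W) (hau : Disjoint a u) {i j : Fin d}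
    (hi : G.Anc (s ∪ t ∪ u) i) (hj : j ∉ u) (h : G.LineAnc a i j) :
    G.Coloured u W i ↔ G.Coloured u W j := by
  have harrow : ∀ x y, x ∉ u → (x ∈ G.par y ∨ y = x) → G.Anc (s ∪ t ∪ u) y →
      (G.Coloured u W y ↔ G.Coloured u W x) := by
    rintro x y hx (hxy | rfl) hy
    · by_cases hyu : y ∈ u
      · simp only [Coloured, hyu, hx, not_true, not_false_iff, true_and, false_and, false_or,
          or_false]
        exact ⟨fun ⟨p, hp, hpu, hpW⟩ => (hW.collider y hyu p hp x hxy hpu hx).1 hpW,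
          fun h => ⟨x, hxy, hx, h⟩⟩
      · simpa [Coloured, hyu, hx] using (hW.arrow x y hxy hx hyu hy).symm
    · rfl
  rw [lineAnc_iff] at h
  induction h with
  | base h => exact harrow _ _ hj h hi
  | step h₁ hk h ih =>
    exact (ih (Finset.disjoint_left.1 hau hk)).trans
      (harrow _ _ hj h ((lineAnc_iff.2 h₁).anc hi))

theorem IsSeparation.coloured_iff_of_colliderLink {s t u : Finset (Fin d)} {W : Set (Fin d)}
    (hW : G.IsSeparation s t u W) (hau : Disjoint a u) (hS : ∀ x ∉ a, x ∈ s ∪ t ∪ u)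
    {i j : Fin d} (h : G.ColliderLink a i j) : G.Coloured u W i ↔ G.Coloured u W j :=
  h.iff_of_lineAnc fun x hx _ hg hxg => hW.coloured_iff_of_lineAnc hau (.base (hS x hx))
    (Finset.disjoint_left.1 hau hg) hxg

theorem IsSeparation.not_coloured {s t u : Finset (Fin d)} {W : Set (Fin d)}
    (hW : G.IsSeparation s t u W) (htu : Disjoint t u) {i : Fin d} (hi : i ∈ t) :
    ¬ G.Coloured u W i := by
  have := hW.notMem_right i hi
  have := Finset.disjoint_left.1 htu hi
  simp_all [Coloured]

theorem IsSeparation.coloured {s t u : Finset (Fin d)} {W : Set (Fin d)}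
    (hW : G.IsSeparation s t u W) (hsu : Disjoint s u) {i : Fin d} (hi : i ∈ s) :
    G.Coloured u W i :=
  Or.inl ⟨Finset.disjoint_left.1 hsu hi, hW.mem_left i hi⟩

section Partition

variable {M α β C : Finset (Fin d)}

/-- For a zero submatrix `𝒫_{α|β.C}`, the colour class of `α` consists of the nodes of `a = α ∪ M`
that are ancestors of `α`, or of a node outside `a` that is linked to `α` through colliders. -/
theorem exists_isSeparation_iff_inducedP_eq_zero (hMβ : Disjoint M β) (hMC : Disjoint M C)
    (hαβ : Disjoint α β) (hαC : Disjoint α C) (hβC : Disjoint β C)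
    (hV : ∀ x, x ∈ M ∨ x ∈ α ∨ x ∈ β ∨ x ∈ C) :
    (∃ W, G.IsSeparation α β C W) ↔ G.inducedP M α β C = 0 := by
  have hS : ∀ x ∉ α ∪ M, x ∈ α ∪ β ∪ C := fun x hx => by
    have := hV x
    simp only [Finset.mem_union] at hx ⊢
    tauto
  rw [inducedP_eq_zero_iff]
  constructor
  · rintro ⟨W, hW⟩ i hi j hj
    have haC : Disjoint (α ∪ M) C := Finset.disjoint_union_left.2 ⟨hαC, hMC⟩
    have hjC : j ∉ C := Finset.disjoint_left.1 hβC hj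
    have hQi := hW.coloured hαC hi
    have hQj := hW.not_coloured hβC hj
    have hanc : G.Anc (α ∪ β ∪ C) i := .base (by simp [hi])
    refine ⟨fun h => hQj ((hW.coloured_iff_of_lineAnc haC hanc hjC h).1 hQi),
      fun h hh c hc hih hhc hcj => hQj ?_⟩
    have hc' : G.Anc (α ∪ β ∪ C) c := .base (by
      simp only [Finset.mem_union] at hc ⊢; tauto)
    exact (hW.coloured_iff_of_lineAnc haC hc' hjC hcj).1
      ((hW.coloured_iff_of_colliderLink haC hS hhc).1
        ((hW.coloured_iff_of_lineAnc haC hanc (Finset.disjoint_left.1 haC hh) hih).1 hQi))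
  · intro hzero
    have hβa : ∀ x ∈ β, x ∉ α ∪ M := fun x hx h => by
      rcases Finset.mem_union.1 h with h | h
      exacts [Finset.disjoint_left.1 hαβ h hx, Finset.disjoint_left.1 hMβ h hx]
    have hCa : ∀ x ∈ C, x ∉ α ∪ M := fun x hx h => by
      rcases Finset.mem_union.1 h with h | h
      exacts [Finset.disjoint_left.1 hαC h hx, Finset.disjoint_left.1 hMC h hx]
    have hba : ∀ x ∉ α ∪ M, x ∈ β ∪ C := fun x hx => by
      have := hV x
      simp only [Finset.mem_union] at hx ⊢
      tauto
    -- `hit c`: there is a chain of colliders from an ancestor of `α` in `a` to the node `c`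
    set hit : Fin d → Prop := fun c =>
      ∃ i ∈ α, ∃ h ∈ α ∪ M, G.LineAnc (α ∪ M) i h ∧ G.ColliderLink (α ∪ M) h c
    have hZ : ∀ c ∉ α ∪ M, hit c → ∀ j ∈ β, ¬ G.LineAnc (α ∪ M) c j :=
      fun c hc ⟨i, hi, h, hh, hih, hhc⟩ j hj => (hzero i hi j hj).2 h hh c (hba c hc) hih hhc
    set W : Set (Fin d) := {x | x ∈ α ∪ M ∧ ((∃ i ∈ α, G.LineAnc (α ∪ M) i x) ∨
      ∃ c ∉ α ∪ M, hit c ∧ G.LineAnc (α ∪ M) c x)}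
    -- `hit` is passed on from a coloured node to every node outside `a` that descends from it
    have hK : ∀ x ∈ W, ∀ z ∉ α ∪ M, G.LineAnc (α ∪ M) z x → hit z := by
      rintro x ⟨hx, ⟨i, hi, hix⟩ | ⟨c, hc, ⟨i, hi, h, hh, hih, hhc⟩, hcx⟩⟩ z hz hzx
      · exact ⟨i, hi, x, hx, hix, hzx.colliderLink_left hz hx⟩
      · exact ⟨i, hi, h, hh, hih, hhc.trans hc (.of_common hc hz hx hcx hzx)⟩
    have hcol : ∀ z ∈ C, ∀ x ∈ G.par z, ∀ y ∈ G.par z, y ∉ C → x ∈ W → y ∈ W := by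
      intro z hz x hx y hy hyC hxW
      have hzhit := hK x hxW z (hCa z hz) (.of_par hx)
      by_cases hya : y ∈ α ∪ M
      · exact ⟨hya, Or.inr ⟨z, hCa z hz, hzhit, .of_par hy⟩⟩
      · have hyβ : y ∈ β := (Finset.mem_union.1 (hba y hya)).resolve_right hyC
        exact (hZ z (hCa z hz) hzhit y hyβ (.of_par hy)).elim
    refine ⟨W, fun i hi => ⟨by simp [hi], Or.inl ⟨i, hi, .refl i⟩⟩, fun i hi h => hβa i hi h.1,
      fun x y hxy hxC hyC hy => ⟨fun hxW => ?_, ?_⟩,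
      fun z hz x hx y hy hxC hyC => ⟨hcol z hz x hx y hy hyC, hcol z hz y hy x hx hxC⟩⟩
    · by_cases hya : y ∈ α ∪ M
      · obtain ⟨e, he, hey⟩ := hy.exists_lineAnc hS
        by_cases hea : e ∈ α
        · exact ⟨hya, Or.inl ⟨e, hea, hey⟩⟩
        · have hea' : e ∉ α ∪ M := by
            simp only [Finset.mem_union, hea, false_or] at he
            exact he.elim (hβa e) (hCa e)
          exact ⟨hya, Or.inr ⟨e, hea', hK x hxW e hea' (hey.trans hya (.of_par hxy)), hey⟩⟩
      · have hyβ : y ∈ β := (Finset.mem_union.1 (hba y hya)).resolve_right hyC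
        exact (hZ y hya (hK x hxW y hya (.of_par hxy)) y hyβ (.refl y)).elim
    · rintro ⟨hya, hyW⟩
      by_cases hxa : x ∈ α ∪ M
      · refine ⟨hxa, hyW.imp (fun ⟨i, hi, h⟩ => ⟨i, hi, h.trans hya (.of_par hxy)⟩)
          fun ⟨c, hc, hch, h⟩ => ⟨c, hc, hch, h.trans hya (.of_par hxy)⟩⟩
      · have hxβ : x ∈ β := (Finset.mem_union.1 (hba x hxa)).resolve_right hxC
        rcases hyW with ⟨i, hi, h⟩ | ⟨c, hc, hch, h⟩
        · exact ((hzero i hi x hxβ).1 (h.trans hya (.of_par hxy))).elim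
        · exact (hZ c hc hch x hxβ (h.trans hya (.of_par hxy))).elim

/-- As all nodes are in play, the only possible colour class is `α` itself. -/
theorem exists_isSeparation_iff_inducedCov_eq_zero (hMα : Disjoint M α) (hMβ : Disjoint M β)
    (hMC : Disjoint M C) (hαβ : Disjoint α β) (hαC : Disjoint α C)
    (hV : ∀ x, x ∈ M ∨ x ∈ α ∨ x ∈ β ∨ x ∈ C) :
    (∃ W, G.IsSeparation α M (β ∪ C) W) ↔ G.inducedCov M α = 0 := by
  have hαb : Disjoint α (β ∪ C) := Finset.disjoint_union_right.2 ⟨hαβ, hαC⟩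
  have hMb : Disjoint M (β ∪ C) := Finset.disjoint_union_right.2 ⟨hMβ, hMC⟩
  have hab : Disjoint (α ∪ M) (β ∪ C) := Finset.disjoint_union_left.2 ⟨hαb, hMb⟩
  have hall : ∀ x, x ∈ α ∪ M ∪ (β ∪ C) := fun x => by
    have := hV x
    simp only [Finset.mem_union]
    tauto
  have hpart : ∀ x ∉ β ∪ C, x ∈ α ∪ M := fun x hx => (Finset.mem_union.1 (hall x)).resolve_right hx
  rw [inducedCov_eq_zero_iff]
  constructor
  · rintro ⟨W, hW⟩ i hi j hj h hh h' hh' hih hl hjh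
    refine hW.not_coloured hMb hj ((hW.coloured_iff_of_lineAnc hab (.base (hall j))
      (Finset.disjoint_left.1 hab hh') hjh).2 ?_)
    exact (hW.coloured_iff_of_colliderLink hab (fun x _ => hall x) hl).1
      ((hW.coloured_iff_of_lineAnc hab (.base (hall i))
        (Finset.disjoint_left.1 hab hh) hih).1 (hW.coloured hαb hi))
  · intro hzero
    have hcol : ∀ z ∈ β ∪ C, ∀ x ∈ G.par z, ∀ y ∈ G.par z, y ∉ β ∪ C → x ∈ α → y ∈ α := by
      intro z hz x hx y hy hyu hxα
      by_contra hyα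
      have hya := hpart y hyu
      have hyM : y ∈ M := (Finset.mem_union.1 hya).resolve_left hyα
      have hxa : x ∈ α ∪ M := Finset.mem_union_left M hxα
      have hza : z ∉ α ∪ M := Finset.disjoint_right.1 hab hz
      refine hzero x hxα y hyM x hxa y hya (.refl x) ?_ (.refl y)
      exact (LineAnc.colliderLink_left (.of_par hx) hza hxa).trans hza
        (LineAnc.colliderLink_right (.of_par hy) hza hya)
    refine ⟨α, fun i hi => hi, fun i hi h => Finset.disjoint_left.1 hMα hi h,
      fun x y hxy hx hy _ => ⟨fun h => ?_, fun h => ?_⟩,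
      fun z hz x hx y hy hxu hyu => ⟨hcol z hz x hx y hy hyu, hcol z hz y hy x hx hxu⟩⟩
    · by_contra hyα
      have hyM := (Finset.mem_union.1 (hpart y hy)).resolve_left hyα
      exact hzero x h y hyM x (hpart x hx) x (hpart x hx) (.refl x) (.refl x) (.of_par hxy)
    · by_contra hxα
      have hxM := (Finset.mem_union.1 (hpart x hx)).resolve_left hxα
      exact hzero y h x hxM x (hpart x hx) x (hpart x hx) (.of_par hxy) (.refl x) (.refl x)

/-- For a zero submatrix `𝒮^{βC.a}`, the colour class of `β` consists of the ancestors of `β` along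
paths with inner nodes in `a = α ∪ M`; without conditioning, no common child has to be considered. -/
theorem exists_isSeparation_iff_inducedCon_eq_zero (hMβ : Disjoint M β) (hMC : Disjoint M C)
    (hαβ : Disjoint α β) (hαC : Disjoint α C)
    (hV : ∀ x, x ∈ M ∨ x ∈ α ∨ x ∈ β ∨ x ∈ C) :
    (∃ W, G.IsSeparation β C ∅ W) ↔ G.inducedCon M α β C = 0 := by
  have hba : ∀ x ∉ α ∪ M, x ∈ β ∪ C := fun x hx => by
    have := hV x
    simp only [Finset.mem_union] at hx ⊢
    tauto
  have hba' : ∀ x ∉ α ∪ M, x ∈ β ∪ C ∪ ∅ := fun x hx => by simpa using hba x hx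
  rw [inducedCon_eq_zero_iff]
  constructor
  · rintro ⟨W, hW⟩ i hi j hj c hc c' hc' hci hl hcj
    have ha : Disjoint (α ∪ M) ∅ := Finset.disjoint_empty_right _
    have hcA : G.Anc (β ∪ C ∪ ∅) c := .base (by simpa using hc)
    have hcA' : G.Anc (β ∪ C ∪ ∅) c' := .base (by simpa using hc')
    refine hW.not_coloured (Finset.disjoint_empty_right _) hj
      ((hW.coloured_iff_of_lineAnc ha hcA' (by simp) hcj).1 ?_)
    exact (hW.coloured_iff_of_colliderLink ha hba' hl).1
      ((hW.coloured_iff_of_lineAnc ha hcA (by simp) hci).2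
        (hW.coloured (Finset.disjoint_empty_right _) hi))
  · intro hzero
    have hβb : ∀ x ∈ β, x ∈ β ∪ C := fun x hx => Finset.mem_union_left C hx
    have hCb : ∀ x ∈ C, x ∈ β ∪ C := fun x hx => Finset.mem_union_right β hx
    have hβa : ∀ x ∈ β, x ∉ α ∪ M := fun x hx h => by
      rcases Finset.mem_union.1 h with h | h
      exacts [Finset.disjoint_left.1 hαβ h hx, Finset.disjoint_left.1 hMβ h hx]
    have hCa : ∀ x ∈ C, x ∉ α ∪ M := fun x hx h => by
      rcases Finset.mem_union.1 h with h | h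
      exacts [Finset.disjoint_left.1 hαC h hx, Finset.disjoint_left.1 hMC h hx]
    set W : Set (Fin d) := {x | ∃ c ∈ β, G.LineAnc (α ∪ M) c x}
    have hWC : ∀ x ∈ C, x ∉ W := fun x hx ⟨c, hc, hcx⟩ =>
      hzero c hc x hx c (hβb c hc) c (hβb c hc) (.refl c) (.refl c) hcx
    -- no node of `C` descends from a node of `W` along a path with inner nodes in `a`
    have hWno : ∀ x ∈ W, ∀ c' ∈ C, ¬ G.LineAnc (α ∪ M) c' x := by
      rintro x hxW c' hc' hcx'
      by_cases hxa : x ∈ α ∪ M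
      · obtain ⟨c, hc, hcx⟩ := hxW
        exact hzero c hc c' hc' c (hβb c hc) c' (hCb c' hc') (.refl c)
          (.of_common (hβa c hc) (hCa c' hc') hxa hcx hcx') (.refl c')
      · have hxβ : x ∈ β := (Finset.mem_union.1 (hba x hxa)).resolve_right fun h => hWC x h hxW
        exact hzero x hxβ c' hc' c' (hCb c' hc') c' (hCb c' hc') hcx' (.refl c') (.refl c')
    refine ⟨W, fun i hi => ⟨i, hi, .refl i⟩, hWC,
      fun x y hxy _ _ hy => ⟨fun hxW => ?_, fun hyW => ?_⟩, by simp⟩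
    · by_cases hya : y ∈ α ∪ M
      · obtain ⟨e, he, hey⟩ := hy.exists_lineAnc hba'
        simp only [Finset.mem_union, Finset.notMem_empty, or_false] at he
        rcases he with he | he
        · exact ⟨e, he, hey⟩
        · exact (hWno x hxW e he (hey.trans hya (.of_par hxy))).elim
      · rcases Finset.mem_union.1 (hba y hya) with h | h
        · exact ⟨y, h, .refl y⟩
        · exact (hWno x hxW y h (.of_par hxy)).elim
    · by_cases hya : y ∈ α ∪ M
      · obtain ⟨c, hc, hcy⟩ := hyW
        exact ⟨c, hc, hcy.trans hya (.of_par hxy)⟩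
      · have hyβ : y ∈ β := (Finset.mem_union.1 (hba y hya)).resolve_right fun h => hWC y h hyW
        exact ⟨y, hyβ, .of_par hxy⟩

end Partition

end ParentGraph

/-! ### The three independences -/

theorem proposition1 {d : ℕ} (G : ParentGraph d) (M α β C : Finset (Fin d))
    (hMα : Disjoint M α) (hMβ : Disjoint M β) (hMC : Disjoint M C)
    (hαβ : Disjoint α β) (hαC : Disjoint α C) (hβC : Disjoint β C)
    (hV : M ∪ α ∪ β ∪ C = Finset.univ) :
    (∀ (P : Measure (Fin d → ℝ)) [IsProbabilityMeasure P], G.Generates P →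
      (CondIndepNodes P α β C ↔ G.inducedP M α β C = 0) ∧
      (CondIndepNodes P α M (β ∪ C) ↔ G.inducedCov M α = 0) ∧
      (CondIndepNodes P β C ∅ ↔ G.inducedCon M α β C = 0)) ∧
    (G.Implies α β C ↔ G.inducedP M α β C = 0) ∧
    (G.Implies α M (β ∪ C) ↔ G.inducedCov M α = 0) ∧
    (G.Implies β C ∅ ↔ G.inducedCon M α β C = 0) := by
  have hV' : ∀ x, x ∈ M ∨ x ∈ α ∨ x ∈ β ∨ x ∈ C := fun x => by
    have := hV ▸ Finset.mem_univ x
    simpa [or_assoc] using this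
  have hMu : Disjoint M (β ∪ C) := Finset.disjoint_union_right.2 ⟨hMβ, hMC⟩
  have hαu : Disjoint α (β ∪ C) := Finset.disjoint_union_right.2 ⟨hαβ, hαC⟩
  have h1 : G.Implies α β C ↔ G.inducedP M α β C = 0 :=
    (ParentGraph.implies_iff_exists_isSeparation hαC hβC).trans
      (ParentGraph.exists_isSeparation_iff_inducedP_eq_zero hMβ hMC hαβ hαC hβC hV')
  have h2 : G.Implies α M (β ∪ C) ↔ G.inducedCov M α = 0 :=
    (ParentGraph.implies_iff_exists_isSeparation hαu hMu).trans
      (ParentGraph.exists_isSeparation_iff_inducedCov_eq_zero hMα hMβ hMC hαβ hαC hV')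
  have h3 : G.Implies β C ∅ ↔ G.inducedCon M α β C = 0 :=
    (ParentGraph.implies_iff_exists_isSeparation (Finset.disjoint_empty_right _)
      (Finset.disjoint_empty_right _)).trans
      (ParentGraph.exists_isSeparation_iff_inducedCon_eq_zero hMβ hMC hαβ hαC hV')
  refine ⟨fun P _ hP => ⟨?_, ?_, ?_⟩, h1, h2, h3⟩
  · exact (hP.2 α β C hαβ hαC hβC).trans h1
  · exact (hP.2 α M (β ∪ C) hMα.symm hαu hMu).trans h2
  · exact (hP.2 β C ∅ hβC (Finset.disjoint_empty_right _) (Finset.disjoint_empty_right _)).trans h3
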